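/- Let $\mathbb{K}$ be a field of characteristic zero. A noncrossing partition is a partition $\pi$ of $[n]=\{1,\dots,n\}$ such that there are no $x<y<z<t$ with $x,z$ in one block and $y,t$ in another block. For $S\subseteq[n]$, let $\pi_{|S}$ be the partition induced on $S$, relabelled by the increasing bijection $S\to[|S|]$. Let $\mathbb{K}[\mathcal{NCP}]$ be the free commutative algebra generated by the noncrossing partitions of nonempty sets $[n]$ (the empty partition being identified with the unit $1$). The connected components of $J\subseteq [n]$ are its maximal subintervals; $J$ is an ideal of $\pi$ if each connected component of $J$ is a union of blocks of $\pi$, and then $\pi_{|\cdot J}$ is the product of the $\pi_{|C}$ over the connected components $C$ of $J$. Consider the two multiplicative coproducts given for a noncrossing partition $\pi$ of $[n]$, $n\ge 1$, by $$\Delta(\pi)=\sum_{J\text{ ideal of }\pi}\pi_{|[n]\setminus J}\otimes\pi_{|\cdot J},\qquad \delta(\pi)=\sum_{\substack{\sigma\text{ noncrossing partition of }[n]\\ \sigma\text{ coarser than or equal to }\pi}}\sigma\otimes\prod_{C\in\sigma}\pi_{|C},$$ whose counits are the algebra morphisms with $\varepsilon_\Delta(\pi)=0$, and with $\epsilon_\delta(\pi)=1$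 if $\pi$ has exactly one block and $\epsilon_\delta(\pi)=0$ otherwise. On $\mathbb{K}[X]$ consider the multiplicative coproducts with $\Delta(X)=X\otimes 1+1\otimes X$ and $\delta(X)=X\otimes X$, whose counits are the evaluations at $0$ and at $1$. Let $H_i=\frac{X(X-1)\cdots(X-i+1)}{i!}$ for $i\ge 0$, and let $\phi:\mathbb{K}[\mathcal{NCP}]\to\mathbb{K}[X]$ be the algebra morphism such that, for every noncrossing partition $\pi$ of $[n]$ with $n\ge1$, $$\phi(\pi)=\sum_{k\ge1}\epsilon_\delta^{\otimes k}\circ\tilde\Delta^{(k-1)}(\pi)\,H_k,$$ a finite sum, where $\tilde\Delta(x)=\Delta(x)-x\otimes1-1\otimes x$ on $\ker\varepsilon_\Delta$, $\tilde\Delta^{(0)}=\mathrm{Id}$ and $\tilde\Delta^{(k)}=(\tilde\Delta^{(k-1)}\otimes\mathrm{Id})\circ\tilde\Delta$. Every algebra morphism $\mathbb{K}[\mathcal{NCP}]\to\mathbb{K}[X]$ compatible with both coproducts and both counits is equal to $\phi$. Let $P_n=\phi(\{\{1\},\dots,\{n\}\})$, with $P_0=1$, and let $a_{i,n}$ be the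 coefficient of $H_i$ in the expansion of $P_n$ in the basis $(H_i)_{i\ge0}$ of $\mathbb{K}[X]$. Then $P_n=\sum_{i=1}^{n}a_{i,n}H_i$ for all $n\ge1$. Moreover $a_{1,n}=\delta_{n,1}$ for all $n\ge1$, and, for $2\le i\le n$, $$a_{i,n}=\sum_{k=1}^{\lfloor (n+1)/2\rfloor}\binom{n-k+1}{k}\,a_{i-1,n-k}.$$ With $\zeta_n(k_1,\dots,k_p)=\sum_{1\le n_1<\dots<n_p\le n}\frac{1}{n_1^{k_1}\cdots n_p^{k_p}}$, one has $$a_{n,n}=n!\quad(n\ge1),\qquad a_{n-1,n}=n!\left(\frac{n+1}{2}-\zeta_n(1)\right)\quad(n\ge2),$$ $$a_{n-2,n}=n!\left(\zeta_n(1,1)-\frac n2\,\zeta_n(1)+\frac{(3n-2)(n^2+n+6)}{24n}\right)\quad(n\ge3).$$ -/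

import Mathlib

open scoped Polynomial TensorProduct

noncomputable section

/-- A noncrossing partition of an `n`-element linearly ordered set, as an equivalence relation
whose classes are the blocks.  The ground set `{1, …, n}` is represented by `Fin n`. -/
@[ext]
structure NCPart (n : ℕ) where
  /-- being in the same block -/
  rel : Setoid (Fin n)
  noncrossing : ∀ x y z t : Fin n, x < y → y < z → z < t → rel x z → rel y t → rel x y

namespace NCPart

instance finite (n : ℕ) : Finite (NCPart n) := by
  refine Finite.of_injective (β := Fin n → Fin n → Prop) (fun p x y => p.rel x y) ?_
  intro p q h
  ext x y
  exact iff_of_eq (congrFun (congrFun h x) y)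

instance fintype (n : ℕ) : Fintype (NCPart n) := Fintype.ofFinite _

open Classical in
/-- The finite set of blocks. -/
def blocks {n : ℕ} (p : NCPart n) : Finset (Finset (Fin n)) :=
  Finset.univ.image fun x => Finset.univ.filter fun y => p.rel x y

/-- The partition induced on a subset `S` of the ground set, transported to `Fin S.card` by the
unique increasing bijection. -/
def restrict {n : ℕ} (p : NCPart n) (S : Finset (Fin n)) : NCPart S.card where
  rel := Setoid.comap (S.orderEmbOfFin rfl) p.rel
  noncrossing _ _ _ _ hxy hyz hzt hxz hyt :=
    p.noncrossing _ _ _ _ ((S.orderEmbOfFin rfl).strictMono hxy)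
      ((S.orderEmbOfFin rfl).strictMono hyz) ((S.orderEmbOfFin rfl).strictMono hzt) hxz hyt

/-- The noncrossing partition `{{1}, …, {n}}`, all of whose blocks are singletons. -/
def singletons (n : ℕ) : NCPart n where
  rel := ⊥
  noncrossing _ _ _ _ _ hyz hzt _ hyt := absurd hyt (ne_of_lt (hyz.trans hzt))

end NCPart

open Classical in
/-- The connected components of a subset `J` of `Fin n`: its maximal subintervals. -/
def intervalComponents {n : ℕ} (J : Finset (Fin n)) : Finset (Finset (Fin n)) :=
  J.image fun x => J.filter fun y => Finset.uIcc x y ⊆ J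

/-- An ideal of `p`, represented by the union `J` of its blocks: every connected component of `J`
is a union of blocks of `p`. -/
def NCPart.IsIdeal {n : ℕ} (p : NCPart n) (J : Finset (Fin n)) : Prop :=
  ∀ C ∈ intervalComponents J, ∀ x ∈ C, ∀ y, p.rel x y → y ∈ C

/-- Nonempty noncrossing partitions; the pair `⟨n, p⟩` is a partition `p` of an `(n+1)`-element
set. -/
abbrev NCP : Type := Σ n : ℕ, NCPart (n + 1)

/-- The free commutative algebra generated by the nonempty noncrossing partitions. -/
abbrev NCPAlg (K : Type*) [Field K] : Type _ := MvPolynomial NCP K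

section Bialgebras

variable (K : Type*) [Field K]

/-- A noncrossing partition as an element of the algebra; the empty partition is the unit. -/
def ncGen : {n : ℕ} → NCPart n → NCPAlg K
  | 0, _ => 1
  | n + 1, p => MvPolynomial.X (⟨n, p⟩ : NCP)

/-- The restriction of `p` to `J` as the commutative monomial of its restrictions to the connected
components of `J`. -/
def ncGenDot {n : ℕ} (p : NCPart n) (J : Finset (Fin n)) : NCPAlg K :=
  ∏ C ∈ intervalComponents J, ncGen K (p.restrict C)

open Classical in
/-- The first coproduct: `Δ(p) = ∑ p|Jᶜ ⊗ p|·J`, the sum being over the ideals `J` of `p`. -/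
def ncDelta : NCPAlg K →ₐ[K] NCPAlg K ⊗[K] NCPAlg K :=
  MvPolynomial.aeval fun p : NCP =>
    ∑ J : Finset (Fin (p.1 + 1)) with p.2.IsIdeal J,
      ncGen K (p.2.restrict Jᶜ) ⊗ₜ[K] ncGenDot K p.2 J

/-- The counit of the first coproduct, which sends every nonempty noncrossing partition to `0`. -/
def ncDeltaCounit : NCPAlg K →ₐ[K] K := MvPolynomial.aeval fun _ : NCP => (0 : K)

open Classical in
/-- The extraction-contraction coproduct.  Merging blocks of `p` so that the result `s` is
noncrossing is the same as choosing a noncrossing partition `s` coarser than `p`; the second tensor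
factor is the monomial of the restrictions of `p` to the blocks of `s`. -/
def ncExtr : NCPAlg K →ₐ[K] NCPAlg K ⊗[K] NCPAlg K :=
  MvPolynomial.aeval fun p : NCP =>
    ∑ s : NCPart (p.1 + 1) with p.2.rel ≤ s.rel,
      ncGen K s ⊗ₜ[K] ∏ C ∈ s.blocks, ncGen K (p.2.restrict C)

/-- The counit of the extraction-contraction coproduct: `1` on the noncrossing partitions with
exactly one block, `0` on the other nonempty ones. -/
def ncExtrCounit : NCPAlg K →ₐ[K] K :=
  MvPolynomial.aeval fun p : NCP => if p.2.blocks.card = 1 then (1 : K) else 0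

/-- The coproduct of `K[X]` with `Δ(X) = X ⊗ 1 + 1 ⊗ X`. -/
def polyDelta : K[X] →ₐ[K] K[X] ⊗[K] K[X] :=
  Polynomial.aeval ((Polynomial.X : K[X]) ⊗ₜ[K] (1 : K[X]) + (1 : K[X]) ⊗ₜ[K] (Polynomial.X : K[X]))

/-- The coproduct of `K[X]` with `δ(X) = X ⊗ X`. -/
def polyExtr : K[X] →ₐ[K] K[X] ⊗[K] K[X] :=
  Polynomial.aeval ((Polynomial.X : K[X]) ⊗ₜ[K] (Polynomial.X : K[X]))

/-- Morphisms of double bialgebras from the algebra of noncrossing partitions to `K[X]`: algebra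
morphisms compatible with both coproducts and both counits.  On `K[X]` the counits are
evaluation at `0` and at `1`. -/
structure IsDoubleBialgHom (φ : NCPAlg K →ₐ[K] K[X]) : Prop where
  map_delta : (Algebra.TensorProduct.map φ φ).comp (ncDelta K) = (polyDelta K).comp φ
  map_deltaCounit : (Polynomial.aeval (0 : K)).comp φ = ncDeltaCounit K
  map_extr : (Algebra.TensorProduct.map φ φ).comp (ncExtr K) = (polyExtr K).comp φ
  map_extrCounit : (Polynomial.aeval (1 : K)).comp φ = ncExtrCounit K

/-- The reduced coproduct `x ↦ Δ(x) - x ⊗ 1 - 1 ⊗ x`, used on the kernel of the counit. -/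
def ncDeltaRed : NCPAlg K →ₗ[K] NCPAlg K ⊗[K] NCPAlg K :=
  (ncDelta K).toLinearMap - (TensorProduct.mk K (NCPAlg K) (NCPAlg K)).flip 1
    - TensorProduct.mk K (NCPAlg K) (NCPAlg K) 1

/-- `iterCounit K k` is, on the kernel of the counit of `Δ`, the linear form obtained by applying
the `(k+1)`-st tensor power of the counit of `δ` to the `k`-th iterated reduced coproduct. -/
def iterCounit : ℕ → (NCPAlg K →ₗ[K] K)
  | 0 => (ncExtrCounit K).toLinearMap
  | k + 1 => LinearMap.mul' K K ∘ₗ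
      TensorProduct.map (iterCounit k) (ncExtrCounit K).toLinearMap ∘ₗ ncDeltaRed K

/-- The Hilbert polynomial `X (X - 1) ⋯ (X - i + 1) / i!`. -/
def hilbertPoly (i : ℕ) : K[X] :=
  Polynomial.C ((i.factorial : K)⁻¹) *
    ∏ j ∈ Finset.range i, (Polynomial.X - Polynomial.C (j : K))

/-- The fundamental polynomial invariant.  On a noncrossing partition of an `m`-element set the
`k`-th iterated reduced coproducts with `k ≥ m` vanish, so the sum over all `k` stops at `m`. -/
def phiNCP : NCPAlg K →ₐ[K] K[X] :=
  MvPolynomial.aeval fun p : NCP =>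
    ∑ k ∈ Finset.range (p.1 + 1),
      iterCounit K k (MvPolynomial.X p) • hilbertPoly K (k + 1)

/-- The image `P_n` of the noncrossing partition with `n` singleton blocks. -/
def ncP (n : ℕ) : K[X] := phiNCP K (ncGen K (NCPart.singletons n))

/-- `1 ≤ n_1 < ⋯ < n_p ≤ n` is encoded by a strictly increasing `f : Fin p → Fin n` with
`n_j = f j + 1`; the truncated nested harmonic sum is the sum of all `1 / (n_1^{k_1} ⋯ n_p^{k_p})`. -/
def nestedHarmonic (n : ℕ) {p : ℕ} (k : Fin p → ℕ) : K :=
  ∑ f : Fin p → Fin n with StrictMono f, ∏ j, 1 / (((f j : ℕ) : K) + 1) ^ k j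

variable [CharZero K]

lemma degree_hilbertPoly (i : ℕ) : (hilbertPoly K i).degree = i := by
  have h : (i.factorial : K)⁻¹ ≠ 0 := inv_ne_zero (Nat.cast_ne_zero.mpr i.factorial_ne_zero)
  rw [hilbertPoly, Polynomial.degree_C_mul h, Polynomial.degree_prod]
  simp only [Polynomial.degree_X_sub_C, Finset.sum_const, Finset.card_range, nsmul_one]

/-- The basis of Hilbert polynomials of `K[X]`. -/
def hilbertBasis : Module.Basis ℕ K K[X] :=
  Polynomial.Sequence.basis ⟨hilbertPoly K, degree_hilbertPoly K⟩ fun i => by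
    rw [isUnit_iff_ne_zero, Polynomial.leadingCoeff_ne_zero]
    exact Polynomial.Sequence.ne_zero _ i

lemma hilbertBasis_apply (i : ℕ) : hilbertBasis K i = hilbertPoly K i :=
  Polynomial.Sequence.basis_eq_self _ _ i

/-- The coefficient `a_{i,n}` of the Hilbert polynomial `H_i` in `P_n`. -/
def ncCoeff (i n : ℕ) : K := (hilbertBasis K).repr (ncP K n) i

end Bialgebras

end

/-! ### Contracting the last tensor factor of the coproduct. -/

section Shift

variable (K : Type*) [Field K]

/-! Contract the right leg of `Δ` with `ε_δ` to get an endomorphism `T` of the algebra. The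
coefficient forms then satisfy `iterCounit (k+1) = iterCounit k ∘ (T - id - ε_δ·1)`
(`iterCounit_succ`). On `K[X]` the same contraction is `f ↦ f(X+1)`, and `f ↦ f(X+1) - f - f(1)`
lowers `H_{i+1}` to `H_i` for `i ≥ 1` and kills `H_1`, so its iterates followed by evaluation at `1`
read off Hilbert coefficients. A double bialgebra morphism intertwines the two operators and the two
forms, which forces every coefficient of its values on generators; the constant ones vanish by the
counit of `Δ`. Hence uniqueness.

For the singleton partition every `J` is an ideal, `ε_δ` selects the `J` without consecutive
elements, and the complement is again a singleton partition. There are `(n-k+1).choose k` such `J`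
of size `k`, which gives the recurrence. Since `a_{i,n} = 0` for `i > n`, near the diagonal it has
at most three terms, and the closed forms follow by induction. -/

/-- The algebra endomorphism `(id ⊗ ε_δ) ∘ Δ`. -/
noncomputable def ncShift : NCPAlg K →ₐ[K] NCPAlg K :=
  (Algebra.TensorProduct.lift (AlgHom.id K (NCPAlg K))
    ((Algebra.ofId K (NCPAlg K)).comp (ncExtrCounit K)) fun _ _ => Commute.all _ _).comp
    (ncDelta K)

/-- The last tensor factor only ever meets `ε_δ`, so it can be contracted at once. Under this
contraction `x ⊗ 1` becomes `x` and `1 ⊗ x` becomes `ε_δ(x)·1`. -/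
lemma iterCounit_succ (k : ℕ) (x : NCPAlg K) :
    iterCounit K (k + 1) x = iterCounit K k (ncShift K x - x - ncExtrCounit K x • 1) := by
  have key : LinearMap.mul' K K ∘ₗ
      TensorProduct.map (iterCounit K k) (ncExtrCounit K).toLinearMap =
      iterCounit K k ∘ₗ (Algebra.TensorProduct.lift (AlgHom.id K (NCPAlg K))
        ((Algebra.ofId K (NCPAlg K)).comp (ncExtrCounit K))
        fun _ _ => Commute.all _ _).toLinearMap := by
    refine TensorProduct.ext' fun a b => ?_
    have : a * (algebraMap K (NCPAlg K)) (ncExtrCounit K b) = ncExtrCounit K b • a := by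
      rw [Algebra.smul_def, mul_comm]
    simp only [LinearMap.comp_apply, TensorProduct.map_tmul, LinearMap.mul'_apply,
      AlgHom.toLinearMap_apply, Algebra.TensorProduct.lift_tmul, AlgHom.id_apply,
      AlgHom.comp_apply, Algebra.ofId_apply, this, map_smul, smul_eq_mul, mul_comm]
  have := LinearMap.congr_fun key (ncDeltaRed K x)
  rw [iterCounit, ← LinearMap.comp_assoc, LinearMap.comp_apply, this, LinearMap.comp_apply]
  congr 1
  simp [ncDeltaRed, ncShift, Algebra.ofId_apply, Algebra.smul_def]

/-- Restrictions live over `Fin S.card`, which matches the expected size only propositionally; this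
compares generators across such an equality. -/
lemma ncGen_eq_of_rel_iff {n m : ℕ} (h : n = m) (p : NCPart n) (q : NCPart m)
    (hpq : ∀ x y, p.rel x y ↔ q.rel (Fin.cast h x) (Fin.cast h y)) :
    ncGen K p = ncGen K q := by
  subst h
  congr 1
  ext x y
  exact hpq x y

lemma ncGen_restrict_univ {n : ℕ} (p : NCPart n) :
    ncGen K (p.restrict Finset.univ) = ncGen K p := by
  have h : (Finset.univ : Finset (Fin n)).card = n := by simp
  refine ncGen_eq_of_rel_iff K h _ _ fun x y => ?_
  have e : ∀ x, (Finset.univ : Finset (Fin n)).orderEmbOfFin rfl x = Fin.cast h x := by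
    have := Finset.orderEmbOfFin_unique (s := (Finset.univ : Finset (Fin n))) rfl
      (f := Fin.cast h) (fun _ => Finset.mem_univ _) (Fin.cast_strictMono h)
    intro x
    rw [this]
  change p.rel _ _ ↔ _
  rw [e, e]

lemma ncGen_eq_one {n : ℕ} (h : n = 0) (p : NCPart n) : ncGen K p = 1 := by
  subst h; rfl

lemma intervalComponents_empty (n : ℕ) : intervalComponents (∅ : Finset (Fin n)) = ∅ := by
  simp [intervalComponents]

lemma intervalComponents_univ (n : ℕ) :
    intervalComponents (Finset.univ : Finset (Fin (n + 1))) = {Finset.univ} := by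
  simp only [intervalComponents, Finset.subset_univ, Finset.filter_true]
  exact Finset.image_const Finset.univ_nonempty _

lemma ncGenDot_empty {n : ℕ} (p : NCPart n) : ncGenDot K p ∅ = 1 := by
  simp [ncGenDot, intervalComponents_empty]

lemma ncGenDot_univ {n : ℕ} (p : NCPart (n + 1)) :
    ncGenDot K p Finset.univ = ncGen K p := by
  rw [ncGenDot, intervalComponents_univ, Finset.prod_singleton, ncGen_restrict_univ]

lemma NCPart.isIdeal_empty {n : ℕ} (p : NCPart n) : p.IsIdeal ∅ := by
  simp [NCPart.IsIdeal, intervalComponents_empty]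

lemma NCPart.isIdeal_univ {n : ℕ} (p : NCPart (n + 1)) : p.IsIdeal Finset.univ := by
  simp [NCPart.IsIdeal, intervalComponents_univ]

open Classical in
lemma ncShift_ncGen {n : ℕ} (p : NCPart (n + 1)) :
    ncShift K (ncGen K p) = ∑ J : Finset (Fin (n + 1)) with p.IsIdeal J,
      ncExtrCounit K (ncGenDot K p J) • ncGen K (p.restrict Jᶜ) := by
  change ncShift K (MvPolynomial.X ⟨n, p⟩) = _
  rw [ncShift, AlgHom.comp_apply, ncDelta, MvPolynomial.aeval_X, map_sum]
  refine Finset.sum_congr rfl fun J _ => ?_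
  simp [Algebra.ofId_apply, Algebra.smul_def, mul_comm]

open Classical in
/-- The reduced version of `ncShift_ncGen`: only the proper nonempty ideals contribute. -/
lemma ncShift_ncGen_sub {n : ℕ} (p : NCPart (n + 1)) :
    ncShift K (ncGen K p) - ncGen K p - ncExtrCounit K (ncGen K p) • 1 =
      ∑ J : Finset (Fin (n + 1)) with p.IsIdeal J ∧ J ≠ ∅ ∧ J ≠ Finset.univ,
        ncExtrCounit K (ncGenDot K p J) • ncGen K (p.restrict Jᶜ) := by
  have hs : (Finset.univ.filter fun J : Finset (Fin (n + 1)) => p.IsIdeal J) =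
      insert ∅ (insert Finset.univ
        (Finset.univ.filter fun J => p.IsIdeal J ∧ J ≠ ∅ ∧ J ≠ Finset.univ)) := by
    ext J
    simp only [Finset.mem_filter, Finset.mem_univ, true_and, Finset.mem_insert]
    constructor
    · tauto
    · rintro (rfl | rfl | h)
      · exact p.isIdeal_empty
      · exact p.isIdeal_univ
      · exact h.1
  have h0 : (∅ : Finset (Fin (n + 1))) ≠ Finset.univ := Finset.univ_nonempty.ne_empty.symm
  rw [ncShift_ncGen, hs, Finset.sum_insert (by simp [h0]), Finset.sum_insert (by simp),
    ncGenDot_empty, ncGenDot_univ, Finset.compl_empty, ncGen_restrict_univ,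
    ncGen_eq_one K (by simp) (p.restrict Finset.univᶜ), map_one, one_smul]
  abel

open Classical in
lemma iterCounit_succ_ncGen (k : ℕ) {n : ℕ} (p : NCPart (n + 1)) :
    iterCounit K (k + 1) (ncGen K p) =
      ∑ J : Finset (Fin (n + 1)) with p.IsIdeal J ∧ J ≠ ∅ ∧ J ≠ Finset.univ,
        ncExtrCounit K (ncGenDot K p J) * iterCounit K k (ncGen K (p.restrict Jᶜ)) := by
  rw [iterCounit_succ, ncShift_ncGen_sub, map_sum]
  simp only [map_smul, smul_eq_mul]

/-- Each reduced step removes a nonempty proper ideal, so the size drops strictly but stays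
positive. Size `0` must be excluded: there the generator is `1`, on which the forms take the values
`(-1)^k`. -/
lemma iterCounit_ncGen_eq_zero (k : ℕ) :
    ∀ {n : ℕ} (p : NCPart n), n ≠ 0 → n ≤ k → iterCounit K k (ncGen K p) = 0 := by
  induction k with
  | zero => intro n p h0 h; omega
  | succ k ih =>
    intro n p h0 h
    obtain ⟨n, rfl⟩ := Nat.exists_eq_succ_of_ne_zero h0
    rw [iterCounit_succ_ncGen]
    refine Finset.sum_eq_zero fun J hJ => ?_
    simp only [Finset.mem_filter, Finset.mem_univ, true_and] at hJ
    rw [ih, mul_zero]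
    · simpa [Finset.card_eq_zero] using hJ.2.2
    · have h1 := Finset.card_compl_add_card J
      have h2 : 0 < J.card := Finset.card_pos.2 (Finset.nonempty_iff_ne_empty.2 hJ.2.1)
      rw [Fintype.card_fin] at h1
      omega

end Shift

/-! ### Hilbert coefficients and uniqueness of the morphism. -/

section Uniqueness

variable (K : Type*) [Field K]

lemma hilbertPoly_zero : hilbertPoly K 0 = 1 := by simp [hilbertPoly]

lemma eval_zero_hilbertPoly_succ (i : ℕ) : (hilbertPoly K (i + 1)).eval 0 = 0 := by
  rw [hilbertPoly, Finset.prod_range_succ']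
  simp

lemma eval_one_hilbertPoly (i : ℕ) :
    (hilbertPoly K (i + 1)).eval 1 = if i = 0 then 1 else 0 := by
  rcases i with _ | i
  · simp [hilbertPoly]
  · rw [hilbertPoly, Finset.prod_range_succ', Finset.prod_range_succ']
    simp

variable [CharZero K]

/-- Pascal's rule: the two products share the factors `X, …, X - i + 1`, and the remaining factors
`X + 1` and `X - i` differ by `i + 1`, which cancels in the factorial. -/
lemma hilbertPoly_comp_X_add_one (i : ℕ) :
    (hilbertPoly K (i + 1)).comp (Polynomial.X + 1) =
      hilbertPoly K (i + 1) + hilbertPoly K i := by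
  have h1 : ((i : K) + 1) ≠ 0 := by exact_mod_cast Nat.succ_ne_zero i
  have h2 : ((i + 1).factorial : K)⁻¹ * ((i : K) + 1) = (i.factorial : K)⁻¹ := by
    have := Nat.cast_ne_zero (R := K).2 i.factorial_ne_zero
    rw [Nat.factorial_succ]; push_cast; field_simp
  have h3 : ∀ j : ℕ, (Polynomial.X + 1 - Polynomial.C ((j + 1 : ℕ) : K) : K[X]) =
      Polynomial.X - Polynomial.C (j : K) := by
    intro j; push_cast; simp
  have h4 : (∏ j ∈ Finset.range (i + 1), (Polynomial.X - Polynomial.C (j : K))).comp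
      (Polynomial.X + 1) = (Polynomial.X + 1) *
        ∏ j ∈ Finset.range i, (Polynomial.X - Polynomial.C (j : K)) := by
    rw [Polynomial.prod_comp, Finset.prod_range_succ', mul_comm]
    congr 1
    · simp
    · refine Finset.prod_congr rfl fun j _ => ?_
      rw [Polynomial.sub_comp, Polynomial.X_comp, Polynomial.C_comp, h3]
  rw [hilbertPoly, hilbertPoly, Polynomial.mul_comp, Polynomial.C_comp, h4,
    Finset.prod_range_succ, ← h2]
  simp only [map_mul, map_add, map_one]
  ring

/-- The polynomial counterparts of the forms `iterCounit`. -/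
noncomputable def polyIterCounit : ℕ → (K[X] →ₗ[K] K)
  | 0 => Polynomial.leval 1
  | k + 1 => polyIterCounit k ∘ₗ
      ((Polynomial.aeval (Polynomial.X + 1 : K[X])).toLinearMap - LinearMap.id
        - (Polynomial.leval 1).smulRight 1)

omit [CharZero K] in
lemma polyIterCounit_hilbertPoly_zero (k : ℕ) :
    polyIterCounit K k (hilbertPoly K 0) = (-1) ^ k := by
  rw [hilbertPoly_zero]
  induction k with
  | zero => simp [polyIterCounit, Polynomial.leval]
  | succ k ih =>
    simp [polyIterCounit, Polynomial.leval, ih, pow_succ]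

lemma polyIterCounit_hilbertPoly_succ (k i : ℕ) :
    polyIterCounit K k (hilbertPoly K (i + 1)) = if i = k then 1 else 0 := by
  induction k generalizing i with
  | zero =>
    change (hilbertPoly K (i + 1)).eval 1 = _
    exact eval_one_hilbertPoly K i
  | succ k ih =>
    have h : polyIterCounit K (k + 1) (hilbertPoly K (i + 1)) = polyIterCounit K k
        ((hilbertPoly K (i + 1)).comp (Polynomial.X + 1) - hilbertPoly K (i + 1)
          - (hilbertPoly K (i + 1)).eval 1 • 1) := rfl
    rw [h, hilbertPoly_comp_X_add_one, add_sub_cancel_left, eval_one_hilbertPoly]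
    -- For `H_1` the difference is `H_0 = 1`, and the term `f(1)` cancels it exactly.
    rcases i with _ | i
    · simp [hilbertPoly_zero]
    · simpa using ih i

/-- The lowering operator sends `1` to `-1`, so constants contribute a sign; that term disappears on
polynomials vanishing at `0`. -/
lemma polyIterCounit_eq (k : ℕ) (Q : K[X]) :
    polyIterCounit K k Q =
      (hilbertBasis K).repr Q (k + 1) + (-1) ^ k * (hilbertBasis K).repr Q 0 := by
  have : polyIterCounit K k =
      (hilbertBasis K).coord (k + 1) + (-1 : K) ^ k • (hilbertBasis K).coord 0 := by
    refine (hilbertBasis K).ext fun i => ?_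
    rw [LinearMap.add_apply, LinearMap.smul_apply, Module.Basis.coord_apply,
      Module.Basis.coord_apply, Module.Basis.repr_self, hilbertBasis_apply]
    rcases i with _ | i
    · rw [polyIterCounit_hilbertPoly_zero]; simp
    · rw [polyIterCounit_hilbertPoly_succ]; simp [Finsupp.single_apply]
  simpa using LinearMap.congr_fun this Q

lemma repr_zero_eq_eval (Q : K[X]) : (hilbertBasis K).repr Q 0 = Q.eval 0 := by
  have : (hilbertBasis K).coord 0 = Polynomial.leval (0 : K) := by
    refine (hilbertBasis K).ext fun i => ?_
    rw [Module.Basis.coord_apply, Module.Basis.repr_self, hilbertBasis_apply]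
    rcases i with _ | i
    · simp [hilbertPoly_zero, Polynomial.leval]
    · simp [Polynomial.leval, eval_zero_hilbertPoly_succ]
  exact LinearMap.congr_fun this Q

/-- The sum defining `phiNCP` is truncated by the size of the partition; `iterCounit_ncGen_eq_zero`
makes the coefficient formula valid for all `i`. -/
lemma repr_phiNCP {n : ℕ} (p : NCPart (n + 1)) :
    (hilbertBasis K).repr (phiNCP K (ncGen K p)) 0 = 0 ∧
    ∀ i, (hilbertBasis K).repr (phiNCP K (ncGen K p)) (i + 1) =
      iterCounit K i (ncGen K p) := by
  have h : ∀ j, (hilbertBasis K).repr (phiNCP K (ncGen K p)) j =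
      ∑ k ∈ Finset.range (n + 1),
        iterCounit K k (ncGen K p) * if k + 1 = j then 1 else 0 := by
    intro j
    have : phiNCP K (ncGen K p) = ∑ k ∈ Finset.range (n + 1),
        iterCounit K k (ncGen K p) • hilbertPoly K (k + 1) := by
      change phiNCP K (MvPolynomial.X ⟨n, p⟩) = _
      rw [phiNCP, MvPolynomial.aeval_X]
      rfl
    rw [this, map_sum, Finsupp.finsetSum_apply]
    refine Finset.sum_congr rfl fun k _ => ?_
    rw [map_smul, ← hilbertBasis_apply, Module.Basis.repr_self]
    simp [Finsupp.single_apply]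
  refine ⟨by rw [h]; simp, fun i => ?_⟩
  rw [h]
  simp only [add_left_inj, mul_ite, mul_one, mul_zero, Finset.sum_ite_eq', Finset.mem_range]
  split_ifs with hi
  · rfl
  · exact (iterCounit_ncGen_eq_zero K i p (by omega) (by omega)).symm

variable {K}

-- Apply `id ⊗ (evaluation at 1)` to the compatibility with `Δ`. On `K[X]` it turns `X ⊗ 1 + 1 ⊗ X`
-- into `X + 1`, and evaluation at `1` after `φ` is `ε_δ`.
omit [CharZero K] in
lemma IsDoubleBialgHom.map_ncShift {φ : NCPAlg K →ₐ[K] K[X]} (hφ : IsDoubleBialgHom K φ)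
    (x : NCPAlg K) : φ (ncShift K x) = (φ x).comp (Polynomial.X + 1) := by
  let e : K[X] ⊗[K] K[X] →ₐ[K] K[X] := Algebra.TensorProduct.lift (AlgHom.id K K[X])
    ((Algebra.ofId K K[X]).comp (Polynomial.aeval (1 : K))) fun _ _ => Commute.all _ _
  have h1 : e.comp (polyDelta K) = Polynomial.aeval (Polynomial.X + 1) := by
    refine Polynomial.algHom_ext ?_
    simp [e, polyDelta, Algebra.ofId_apply]
  have h2 : e.comp (Algebra.TensorProduct.map φ φ) =
      φ.comp (Algebra.TensorProduct.lift (AlgHom.id K (NCPAlg K))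
        ((Algebra.ofId K (NCPAlg K)).comp (ncExtrCounit K)) fun _ _ => Commute.all _ _) := by
    refine Algebra.TensorProduct.ext' fun a b => ?_
    have hb : (φ b).eval 1 = ncExtrCounit K b := by
      rw [← hφ.map_extrCounit]; simp
    simp [e, Algebra.ofId_apply, hb, ← MvPolynomial.algebraMap_eq]
  have h3 := AlgHom.congr_fun (congrArg e.comp hφ.map_delta) x
  rw [← AlgHom.comp_assoc, ← AlgHom.comp_assoc, h1, h2] at h3
  exact h3

omit [CharZero K] in
lemma IsDoubleBialgHom.iterCounit_eq {φ : NCPAlg K →ₐ[K] K[X]} (hφ : IsDoubleBialgHom K φ)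
    (k : ℕ) (x : NCPAlg K) : iterCounit K k x = polyIterCounit K k (φ x) := by
  have h : ∀ x, ncExtrCounit K x = (φ x).eval 1 := fun x => by
    rw [← hφ.map_extrCounit]; simp
  induction k generalizing x with
  | zero => exact h x
  | succ k ih =>
    rw [iterCounit_succ, ih, map_sub φ, map_sub φ, hφ.map_ncShift, map_smul φ, map_one, h]
    rfl

theorem IsDoubleBialgHom.eq_phiNCP {φ : NCPAlg K →ₐ[K] K[X]} (hφ : IsDoubleBialgHom K φ) :
    φ = phiNCP K := by
  refine MvPolynomial.algHom_ext fun ⟨n, p⟩ => ?_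
  change φ (ncGen K p) = phiNCP K (ncGen K p)
  have h0 : (hilbertBasis K).repr (φ (ncGen K p)) 0 = 0 := by
    have := AlgHom.congr_fun hφ.map_deltaCounit (MvPolynomial.X ⟨n, p⟩)
    rw [repr_zero_eq_eval]
    rw [ncDeltaCounit, MvPolynomial.aeval_X, AlgHom.comp_apply, Polynomial.coe_aeval_eq_eval] at this
    exact this
  refine (hilbertBasis K).repr.injective (Finsupp.ext fun i => ?_)
  rcases i with _ | i
  · rw [h0, (repr_phiNCP K p).1]
  · rw [(repr_phiNCP K p).2, hφ.iterCounit_eq, polyIterCounit_eq, h0, mul_zero, add_zero]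

end Uniqueness

/-! ### Counting subsets without consecutive elements. -/

section Sparse

/-- A finite set of naturals without two consecutive elements. -/
def IsSparse (S : Finset ℕ) : Prop := ∀ x ∈ S, x + 1 ∉ S

-- Split on whether the largest point `n + 1` of `range (n + 2)` is chosen. If it is, `n` is
-- excluded and the rest is a sparse subset of `range n`; the two counts add up by Pascal's rule.
open Classical in
lemma card_sparse_powersetCard (n k : ℕ) :
    (((Finset.range n).powersetCard k).filter IsSparse).card = (n + 1 - k).choose k := by
  induction n using Nat.strong_induction_on generalizing k with
  | _ n ih =>
  rcases k with _ | k
  · simp [Finset.filter_singleton, IsSparse]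
  rcases n with _ | _ | n
  · simp
  · rcases k with _ | k
    · simp [Finset.powersetCard_one, IsSparse, Finset.filter_singleton]
    · rw [Finset.powersetCard_eq_empty.2 (by simp)]
      simp
  have hsplit : ((Finset.range (n + 2)).powersetCard (k + 1)).filter IsSparse =
      ((Finset.range (n + 1)).powersetCard (k + 1)).filter IsSparse ∪
      (((Finset.range n).powersetCard k).filter IsSparse).image (insert (n + 1)) := by
    ext S
    simp only [Finset.mem_union, Finset.mem_filter, Finset.mem_powersetCard, Finset.mem_image]
    constructor
    · rintro ⟨⟨h1, h2⟩, h3⟩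
      by_cases hn : n + 1 ∈ S
      · right
        refine ⟨S.erase (n + 1), ⟨⟨fun x hx => ?_, ?_⟩, ?_⟩, Finset.insert_erase hn⟩
        · have hx' := Finset.mem_of_mem_erase hx
          have a := Finset.mem_range.1 (h1 hx')
          have b := Finset.ne_of_mem_erase hx
          have c : x ≠ n := by rintro rfl; exact h3 _ hx' hn
          rw [Finset.mem_range]; omega
        · rw [Finset.card_erase_of_mem hn, h2]; rfl
        · exact fun x hx hx' => h3 x (Finset.mem_of_mem_erase hx) (Finset.mem_of_mem_erase hx')
      · left
        refine ⟨⟨fun x hx => ?_, h2⟩, h3⟩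
        have a := Finset.mem_range.1 (h1 hx)
        have b : x ≠ n + 1 := by rintro rfl; exact hn hx
        rw [Finset.mem_range]; omega
    · rintro (⟨⟨h1, h2⟩, h3⟩ | ⟨T, ⟨⟨h1, h2⟩, h3⟩, rfl⟩)
      · exact ⟨⟨h1.trans (Finset.range_subset_range.2 (by omega)), h2⟩, h3⟩
      · have hT : ∀ x ∈ T, x < n := fun x hx => Finset.mem_range.1 (h1 hx)
        refine ⟨⟨fun x hx => ?_, ?_⟩, fun x hx hx' => ?_⟩
        · rcases Finset.mem_insert.1 hx with rfl | hx
          · simp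
          · have := hT x hx
            rw [Finset.mem_range]; omega
        · rw [Finset.card_insert_of_notMem, h2]
          intro h; have := hT _ h; omega
        · rcases Finset.mem_insert.1 hx with rfl | hx
          · rcases Finset.mem_insert.1 hx' with h | h
            · omega
            · have := hT _ h; omega
          · rcases Finset.mem_insert.1 hx' with h | h
            · have := hT _ hx; omega
            · exact h3 _ hx h
  rw [hsplit, Finset.card_union_of_disjoint, Finset.card_image_of_injOn, ih _ (by omega),
    ih _ (by omega)]
  · by_cases h : k ≤ n + 1
    · obtain ⟨m, hm⟩ := Nat.exists_eq_add_of_le h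
      have e1 : n + 1 + 1 - (k + 1) = m := by omega
      have e2 : n + 1 - k = m := by omega
      have e3 : n + 2 + 1 - (k + 1) = m + 1 := by omega
      rw [e1, e2, e3, Nat.choose_succ_succ, add_comm]
    -- Here the natural subtractions truncate to `0`, and all three binomials vanish.
    · rw [Nat.choose_eq_zero_of_lt (n := n + 1 + 1 - (k + 1)) (by omega),
        Nat.choose_eq_zero_of_lt (n := n + 1 - k) (by omega),
        Nat.choose_eq_zero_of_lt (by omega)]
  · intro S hS T hT h
    have key : ∀ S ∈ ((Finset.range n).powersetCard k).filter IsSparse, n + 1 ∉ S := by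
      intro S hS h
      have := (Finset.mem_powersetCard.1 (Finset.mem_filter.1 hS).1).1 h
      simp at this
    rw [← Finset.erase_insert (key S hS), ← Finset.erase_insert (key T hT)]
    exact congrArg (fun U => Finset.erase U (n + 1)) h
  · rw [Finset.disjoint_left]
    intro S hS hS'
    obtain ⟨T, -, rfl⟩ := Finset.mem_image.1 hS'
    have := (Finset.mem_powersetCard.1 (Finset.mem_filter.1 hS).1).1
      (Finset.mem_insert_self (n + 1) T)
    simp at this

open Classical in
lemma card_sparse_fin (n k : ℕ) :
    (Finset.univ.filter fun J : Finset (Fin n) =>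
      IsSparse (J.map Fin.valEmbedding) ∧ J.card = k).card = (n + 1 - k).choose k := by
  rw [← card_sparse_powersetCard]
  refine Finset.card_bij (fun J _ => J.map Fin.valEmbedding) ?_ ?_ ?_
  · intro J hJ
    simp only [Finset.mem_filter, Finset.mem_univ, true_and] at hJ
    simp only [Finset.mem_filter, Finset.mem_powersetCard, Finset.card_map]
    refine ⟨⟨fun x hx => ?_, hJ.2⟩, hJ.1⟩
    obtain ⟨y, -, rfl⟩ := Finset.mem_map.1 hx
    simp
  · intro J _ J' _ h
    exact Finset.map_injective _ h
  · intro S hS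
    simp only [Finset.mem_filter, Finset.mem_powersetCard] at hS
    have hS' : ∀ x ∈ S, x < n := fun x hx => Finset.mem_range.1 (hS.1.1 hx)
    have e : (S.attachFin hS').map Fin.valEmbedding = S := Finset.map_valEmbedding_attachFin hS'
    refine ⟨S.attachFin hS', ?_, e⟩
    simp only [Finset.mem_filter, Finset.mem_univ, true_and]
    rw [e, Finset.card_attachFin]
    exact ⟨hS.2, hS.1.2⟩

/-- Consecutive elements of `J` share a component. Conversely, if the component of `x` contains `y ≠
x`, then `J` contains the whole interval between them, hence the successor of the smaller one. -/
lemma intervalComponents_card_eq_one_iff {n : ℕ} (J : Finset (Fin n)) :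
    (∀ C ∈ intervalComponents J, C.card = 1) ↔ IsSparse (J.map Fin.valEmbedding) := by
  classical
  constructor
  · intro h x hx hx'
    obtain ⟨a, ha, rfl⟩ := Finset.mem_map.1 hx
    obtain ⟨b, hb, hab⟩ := Finset.mem_map.1 hx'
    simp only [Fin.valEmbedding_apply] at hab
    have hC := h (J.filter fun y => Finset.uIcc a y ⊆ J)
      (by rw [intervalComponents]; exact Finset.mem_image_of_mem _ ha)
    have := Finset.card_le_one.1 hC.le a (by simp [ha]) b (by
      simp only [Finset.mem_filter, hb, true_and]
      intro z hz
      rw [Finset.uIcc_of_le (Fin.le_def.2 (by omega)), Finset.mem_Icc, Fin.le_def,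
        Fin.le_def] at hz
      have : z = a ∨ z = b := by
        rw [Fin.ext_iff, Fin.ext_iff]; omega
      rcases this with rfl | rfl <;> assumption)
    rw [this] at hab; omega
  · intro h C hC
    rw [intervalComponents, Finset.mem_image] at hC
    obtain ⟨x, hx, rfl⟩ := hC
    rw [Finset.card_eq_one]
    refine ⟨x, ?_⟩
    ext y
    simp only [Finset.mem_filter, Finset.mem_singleton]
    constructor
    · rintro ⟨hy, hs⟩
      by_contra hne
      have key : ∀ a ∈ J, ∀ b : Fin n, (a : ℕ) + 1 = b → b ∈ J → False := fun a ha b hab hb =>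
        h a (Finset.mem_map_of_mem Fin.valEmbedding ha)
          (by rw [hab]; exact Finset.mem_map_of_mem Fin.valEmbedding hb)
      rcases lt_or_gt_of_ne hne with hlt | hlt
      · have hlt' := Fin.lt_def.1 hlt
        refine key y hy ⟨y + 1, by omega⟩ rfl (hs ?_)
        rw [Finset.uIcc_of_ge hlt.le, Finset.mem_Icc, Fin.le_def, Fin.le_def]
        simp; omega
      · have hlt' := Fin.lt_def.1 hlt
        refine key x hx ⟨x + 1, by omega⟩ rfl (hs ?_)
        rw [Finset.uIcc_of_le hlt.le, Finset.mem_Icc, Fin.le_def, Fin.le_def]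
        simp; omega
    · rintro rfl
      simp [hx]

end Sparse

/-! ### The recurrence for singleton partitions. -/

section Coefficients

variable (K : Type*) [Field K]

lemma NCPart.isIdeal_singletons {n : ℕ} (J : Finset (Fin n)) :
    (NCPart.singletons n).IsIdeal J := by
  rintro C - x hx y rfl
  exact hx

lemma NCPart.restrict_singletons {n : ℕ} (J : Finset (Fin n)) :
    (NCPart.singletons n).restrict J = NCPart.singletons J.card := by
  ext x y
  exact (J.orderEmbOfFin rfl).injective.eq_iff

lemma NCPart.card_blocks_singletons (n : ℕ) : (NCPart.singletons n).blocks.card = n := by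
  classical
  rw [NCPart.blocks, Finset.card_image_of_injective, Finset.card_univ, Fintype.card_fin]
  intro x y h
  have : y ∈ Finset.univ.filter fun z => (NCPart.singletons n).rel x z := by
    rw [show (Finset.univ.filter fun z => (NCPart.singletons n).rel x z) = _ from h]
    exact Finset.mem_filter.2 ⟨Finset.mem_univ _, rfl⟩
  exact (Finset.mem_filter.1 this).2

lemma ncExtrCounit_singletons {n : ℕ} (hn : n ≠ 0) :
    ncExtrCounit K (ncGen K (NCPart.singletons n)) = if n = 1 then 1 else 0 := by
  obtain ⟨n, rfl⟩ := Nat.exists_eq_succ_of_ne_zero hn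
  change ncExtrCounit K (MvPolynomial.X ⟨n, _⟩) = _
  rw [ncExtrCounit, MvPolynomial.aeval_X]
  simp only [NCPart.card_blocks_singletons]

lemma intervalComponents_card_ne_zero {n : ℕ} {J C : Finset (Fin n)}
    (hC : C ∈ intervalComponents J) : C.card ≠ 0 := by
  classical
  rw [intervalComponents, Finset.mem_image] at hC
  obtain ⟨x, hx, rfl⟩ := hC
  exact Finset.card_ne_zero_of_mem (a := x) (by simp [hx])

-- By multiplicativity the value is a product over components, each of which is itself a singleton
-- partition and contributes `1` or `0` according to whether it has one point.
open Classical in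
lemma ncExtrCounit_ncGenDot_singletons {n : ℕ} (J : Finset (Fin n)) :
    ncExtrCounit K (ncGenDot K (NCPart.singletons n) J) =
      if IsSparse (J.map Fin.valEmbedding) then 1 else 0 := by
  have h : ∀ C ∈ intervalComponents J,
      ncExtrCounit K (ncGen K ((NCPart.singletons n).restrict C)) =
        if C.card = 1 then 1 else 0 := fun C hC => by
    rw [NCPart.restrict_singletons,
      ncExtrCounit_singletons K (intervalComponents_card_ne_zero hC)]
  rw [ncGenDot, map_prod, Finset.prod_congr rfl h, Finset.prod_ite_zero, Finset.prod_const_one]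
  simp only [intervalComponents_card_eq_one_iff]

/-- The contribution of a sparse `J` depends only on its size, so the sum over ideals is grouped by
cardinality. -/
lemma iterCounit_succ_singletons (k : ℕ) {n : ℕ} (hn : 2 ≤ n) :
    iterCounit K (k + 1) (ncGen K (NCPart.singletons n)) =
      ∑ j ∈ Finset.Icc 1 ((n + 1) / 2), ((n - j + 1).choose j : K) *
        iterCounit K k (ncGen K (NCPart.singletons (n - j))) := by
  classical
  obtain ⟨n, rfl⟩ := Nat.exists_eq_succ_of_ne_zero (n := n) (by omega)
  have hterm : ∀ J : Finset (Fin (n + 1)),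
      ncExtrCounit K (ncGenDot K (NCPart.singletons (n + 1)) J) *
        iterCounit K k (ncGen K ((NCPart.singletons (n + 1)).restrict Jᶜ)) =
      if IsSparse (J.map Fin.valEmbedding) then
        iterCounit K k (ncGen K (NCPart.singletons (n + 1 - J.card))) else 0 := by
    intro J
    rw [ncExtrCounit_ncGenDot_singletons, NCPart.restrict_singletons, Finset.card_compl,
      Fintype.card_fin, ite_mul, one_mul, zero_mul]
  rw [iterCounit_succ_ncGen, Finset.sum_congr rfl fun J _ => hterm J, ← Finset.sum_filter,
    Finset.filter_filter, ← Finset.sum_fiberwise_of_maps_to (g := Finset.card)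
    (t := Finset.Icc 1 ((n + 1 + 1) / 2))]
  · refine Finset.sum_congr rfl fun j hj => ?_
    rw [Finset.mem_Icc] at hj
    have hset : (Finset.univ.filter fun J : Finset (Fin (n + 1)) =>
        ((NCPart.singletons (n + 1)).IsIdeal J ∧ J ≠ ∅ ∧ J ≠ Finset.univ) ∧
          IsSparse (J.map Fin.valEmbedding)).filter (fun J => J.card = j) =
        Finset.univ.filter fun J : Finset (Fin (n + 1)) =>
          IsSparse (J.map Fin.valEmbedding) ∧ J.card = j := by
      ext J
      simp only [Finset.mem_filter, Finset.mem_univ, true_and, NCPart.isIdeal_singletons]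
      constructor
      · tauto
      · rintro ⟨h1, h2⟩
        -- A size between `1` and `(n + 2) / 2` excludes both `∅` and, as `n ≥ 1`, the full set.
        refine ⟨⟨⟨?_, ?_⟩, h1⟩, h2⟩
        · rintro rfl
          simp at h2; omega
        · rintro rfl
          simp at h2; omega
    have e : n + 1 - j + 1 = n + 1 + 1 - j := by omega
    rw [hset, e, ← card_sparse_fin, ← nsmul_eq_mul, ← Finset.sum_const]
    refine Finset.sum_congr rfl fun J hJ => ?_
    rw [(Finset.mem_filter.1 hJ).2.2]
  · intro J hJ
    simp only [Finset.mem_filter, Finset.mem_univ, true_and] at hJ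
    have h1 : 0 < J.card := Finset.card_pos.2 (Finset.nonempty_iff_ne_empty.2 hJ.1.2.1)
    -- The bound on the size comes from the count itself: `J` is a member of its class, so the
    -- binomial is nonzero.
    have h2 : (n + 1 + 1 - J.card).choose J.card ≠ 0 := by
      rw [← card_sparse_fin]
      exact Finset.card_ne_zero_of_mem (a := J) (by simp [hJ.2])
    have h3 : J.card ≤ n + 1 + 1 - J.card := by
      by_contra h
      exact h2 (Nat.choose_eq_zero_of_lt (by omega))
    rw [Finset.mem_Icc]; omega

variable [CharZero K]

lemma ncCoeff_zero {n : ℕ} (hn : n ≠ 0) : ncCoeff K 0 n = 0 := by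
  obtain ⟨n, rfl⟩ := Nat.exists_eq_succ_of_ne_zero hn
  exact (repr_phiNCP K _).1

lemma ncCoeff_succ (i : ℕ) {n : ℕ} (hn : n ≠ 0) :
    ncCoeff K (i + 1) n = iterCounit K i (ncGen K (NCPart.singletons n)) := by
  obtain ⟨n, rfl⟩ := Nat.exists_eq_succ_of_ne_zero hn
  exact (repr_phiNCP K _).2 i

lemma ncCoeff_eq_zero_of_lt {i n : ℕ} (hn : n ≠ 0) (h : n < i) : ncCoeff K i n = 0 := by
  obtain ⟨i, rfl⟩ := Nat.exists_eq_succ_of_ne_zero (n := i) (by omega)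
  rw [ncCoeff_succ K i hn, iterCounit_ncGen_eq_zero K i _ hn (by omega)]

lemma ncCoeff_one {n : ℕ} (hn : n ≠ 0) : ncCoeff K 1 n = if n = 1 then 1 else 0 := by
  rw [ncCoeff_succ K 0 hn]
  exact ncExtrCounit_singletons K hn

lemma ncP_eq_sum {n : ℕ} (hn : n ≠ 0) :
    ncP K n = ∑ i ∈ Finset.Icc 1 n, ncCoeff K i n • hilbertPoly K i := by
  refine (hilbertBasis K).repr.injective (Finsupp.ext fun j => ?_)
  change ncCoeff K j n = _
  have h : (hilbertBasis K).repr (∑ i ∈ Finset.Icc 1 n, ncCoeff K i n • hilbertPoly K i) j =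
      ∑ i ∈ Finset.Icc 1 n, if i = j then ncCoeff K i n else 0 := by
    rw [map_sum, Finsupp.finsetSum_apply]
    refine Finset.sum_congr rfl fun i _ => ?_
    rw [map_smul, ← hilbertBasis_apply, Module.Basis.repr_self]
    simp [Finsupp.single_apply]
  rw [h, Finset.sum_ite_eq']
  split_ifs with hj
  · rfl
  rw [Finset.mem_Icc] at hj
  rcases j with _ | j
  · exact ncCoeff_zero K hn
  · exact ncCoeff_eq_zero_of_lt K hn (by omega)

lemma ncCoeff_recurrence {i n : ℕ} (hi : 2 ≤ i) (hn : 2 ≤ n) :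
    ncCoeff K i n = ∑ k ∈ Finset.Icc 1 ((n + 1) / 2),
      ((n - k + 1).choose k : K) * ncCoeff K (i - 1) (n - k) := by
  obtain ⟨i, rfl⟩ := Nat.exists_eq_add_of_le' hi
  rw [ncCoeff_succ K (i + 1) (by omega), iterCounit_succ_singletons K i hn]
  refine Finset.sum_congr rfl fun k hk => ?_
  rw [Finset.mem_Icc] at hk
  rw [show i + 2 - 1 = i + 1 from rfl, ncCoeff_succ K i (by omega)]

/-- For `i` close to `n` only the terms of the recurrence with `k ≤ m` survive. -/
lemma ncCoeff_recurrence_truncated {i n m : ℕ} (hi : 2 ≤ i) (hn : 2 ≤ n) (hmn : m < n)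
    (h : n ≤ i + m - 1) :
    ncCoeff K i n = ∑ k ∈ Finset.Icc 1 m,
      ((n - k + 1).choose k : K) * ncCoeff K (i - 1) (n - k) := by
  rw [ncCoeff_recurrence K hi hn]
  have h1 : ∀ k, (n + 1) / 2 < k → k < n → (n - k + 1).choose k = 0 :=
    fun k hk _ => Nat.choose_eq_zero_of_lt (by omega)
  rcases le_total ((n + 1) / 2) m with hm | hm
  -- The added terms have zero binomials.
  · refine Finset.sum_subset (Finset.Icc_subset_Icc_right hm) fun k hk hk' => ?_
    rw [Finset.mem_Icc] at hk hk'
    rw [h1 k (by omega) (by omega), Nat.cast_zero, zero_mul]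
  -- The dropped terms have `n - k < i - 1`, where the coefficient vanishes.
  · refine (Finset.sum_subset (Finset.Icc_subset_Icc_right hm) fun k hk hk' => ?_).symm
    rw [Finset.mem_Icc] at hk hk'
    rw [ncCoeff_eq_zero_of_lt K (by omega) (by omega), mul_zero]

/-! ### Closed forms near the diagonal. -/

lemma ncCoeff_self (n : ℕ) : ncCoeff K (n + 1) (n + 1) = ((n + 1).factorial : K) := by
  induction n with
  | zero => simp [ncCoeff_one]
  | succ n ih =>
    rw [ncCoeff_recurrence_truncated K (m := 1) (by omega) (by omega) (by omega) (by omega)]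
    simp [ih, Nat.factorial_succ (n + 1)]

omit [CharZero K] in
lemma nestedHarmonic_one (n : ℕ) :
    nestedHarmonic K n ![1] = ∑ i ∈ Finset.range n, 1 / ((i : K) + 1) := by
  classical
  rw [nestedHarmonic, Finset.filter_true_of_mem fun f _ => Subsingleton.strictMono f,
    ← Fin.sum_univ_eq_sum_range fun i => 1 / ((i : K) + 1)]
  exact Fintype.sum_equiv (Equiv.funUnique (Fin 1) (Fin n)) _ _ fun f => by simp

omit [CharZero K] in
lemma nestedHarmonic_one_one (n : ℕ) :
    nestedHarmonic K n ![1, 1] = ∑ j ∈ Finset.range n, ∑ i ∈ Finset.range j,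
      1 / ((i : K) + 1) * (1 / ((j : K) + 1)) := by
  classical
  have h : ∀ j ∈ Finset.range n, (∑ i ∈ Finset.range j,
      1 / ((i : K) + 1) * (1 / ((j : K) + 1))) = ∑ i ∈ Finset.range n,
      if i < j then 1 / ((i : K) + 1) * (1 / ((j : K) + 1)) else 0 := by
    intro j hj
    rw [← Finset.sum_filter]
    refine Finset.sum_congr ?_ fun _ _ => rfl
    ext i
    simp only [Finset.mem_range, Finset.mem_filter] at hj ⊢
    omega
  rw [Finset.sum_congr rfl h, Finset.sum_comm, nestedHarmonic, Finset.sum_filter]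
  simp_rw [Finset.sum_range]
  rw [← Fintype.sum_prod_type']
  refine Fintype.sum_equiv (finTwoArrowEquiv _) _ _ fun f => ?_
  simp [Fin.strictMono_iff_lt_succ, Fin.prod_univ_two, mul_comm]

omit [CharZero K] in
lemma nestedHarmonic_one_succ (n : ℕ) :
    nestedHarmonic K (n + 1) ![1] = nestedHarmonic K n ![1] + 1 / ((n : K) + 1) := by
  rw [nestedHarmonic_one, nestedHarmonic_one, Finset.sum_range_succ]

omit [CharZero K] in
lemma nestedHarmonic_one_one_succ (n : ℕ) :
    nestedHarmonic K (n + 1) ![1, 1] =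
      nestedHarmonic K n ![1, 1] + nestedHarmonic K n ![1] / ((n : K) + 1) := by
  rw [nestedHarmonic_one_one, nestedHarmonic_one_one, nestedHarmonic_one,
    Finset.sum_range_succ, ← Finset.sum_mul, div_eq_mul_one_div (Finset.sum _ _)]

/-- With `b_n = a_{n-1,n} / n!`, the two surviving terms give `b_n = b_{n-1} + 1/2 - 1/n`, starting
from `b_2 = 0`. The harmonic sum accumulates the `1/n`. -/
lemma ncCoeff_pred (n : ℕ) :
    ncCoeff K (n + 1) (n + 2) = ((n + 2).factorial : K) *
      (((n : K) + 3) / 2 - nestedHarmonic K (n + 2) ![1]) := by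
  induction n with
  | zero =>
    rw [ncCoeff_one K (by omega), nestedHarmonic_one]
    norm_num [Finset.sum_range_succ]
  | succ n ih =>
    rw [ncCoeff_recurrence_truncated K (m := 2) (by omega) (by omega) (by omega) (by omega),
      Finset.sum_Icc_succ_top (by omega), Finset.Icc_self, Finset.sum_singleton]
    have e1 : n + 1 + 2 - 1 + 1 = n + 3 := by omega
    have e2 : n + 1 + 2 - 1 = n + 2 := by omega
    have e3 : n + 1 + 2 - (1 + 1) = n + 1 := by omega
    have e4 : n + 1 + 1 - 1 = n + 1 := by omega
    rw [e1, e2, e3, e4, ih, ncCoeff_self, nestedHarmonic_one_succ K (n + 2),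
      Nat.choose_one_right, Nat.cast_choose_two]
    have h3 : ((n : K) + 3) ≠ 0 := by exact_mod_cast Nat.succ_ne_zero (n + 2)
    have h3' : ((n : K) + 2 + 1) ≠ 0 := by exact_mod_cast Nat.succ_ne_zero (n + 2)
    rw [Nat.factorial_succ (n + 2), Nat.factorial_succ (n + 1)]
    push_cast
    field_simp
    ring

lemma cast_choose_add_two_three (n : ℕ) :
    ((n + 2).choose 3 : K) = ((n : K) + 2) * (n + 1) * n / 6 := by
  induction n with
  | zero => simp
  | succ n ih =>
    rw [Nat.choose_succ_succ (n + 2) 2, Nat.cast_add, ih, Nat.cast_choose_two]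
    push_cast
    ring

/-- With `c_n = a_{n-2,n} / n!` and `b_n` as in `ncCoeff_pred`, the three terms give `c_n = c_{n-1}
+ (1/2 - 1/n) b_{n-2} + (n-3)(n-4) / (6n(n-1))`. Up to rational terms, the part `ζ_{n-2}(1)/n` is
the increment of `ζ_n(1,1)` and `-ζ_{n-2}(1)/2` that of `-(n/2) ζ_n(1)`. -/
lemma ncCoeff_pred_pred (n : ℕ) :
    ncCoeff K (n + 1) (n + 3) = ((n + 3).factorial : K) *
      (nestedHarmonic K (n + 3) ![1, 1] - ((n : K) + 3) / 2 * nestedHarmonic K (n + 3) ![1] +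
        (3 * ((n : K) + 3) - 2) * (((n : K) + 3) ^ 2 + ((n : K) + 3) + 6) /
          (24 * ((n : K) + 3))) := by
  induction n with
  | zero =>
    rw [ncCoeff_one K (by omega), nestedHarmonic_one, nestedHarmonic_one_one]
    norm_num [Finset.sum_range_succ]
  | succ n ih =>
    rw [ncCoeff_recurrence_truncated K (m := 3) (by omega) (by omega) (by omega) (by omega),
      Finset.sum_Icc_succ_top (by omega), Finset.sum_Icc_succ_top (by omega), Finset.Icc_self,
      Finset.sum_singleton]
    have e1 : n + 1 + 3 - 1 + 1 = n + 4 := by omega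
    have e2 : n + 1 + 3 - 1 = n + 3 := by omega
    have e3 : n + 1 + 3 - (1 + 1) = n + 2 := by omega
    have e4 : n + 1 + 3 - (2 + 1) = n + 1 := by omega
    have e5 : n + 1 + 1 - 1 = n + 1 := by omega
    rw [e1, e2, e3, e4, e5, ih, ncCoeff_self, ncCoeff_pred, nestedHarmonic_one_one_succ K (n + 3),
      nestedHarmonic_one_succ K (n + 3), nestedHarmonic_one_succ K (n + 2),
      Nat.choose_one_right, Nat.cast_choose_two, cast_choose_add_two_three]
    have h4 : ((n : K) + 4) ≠ 0 := by exact_mod_cast Nat.succ_ne_zero (n + 3)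
    have h4' : ((n : K) + 3 + 1) ≠ 0 := by exact_mod_cast Nat.succ_ne_zero (n + 3)
    have h4'' : ((n : K) + 1 + 3) ≠ 0 := by exact_mod_cast Nat.succ_ne_zero (n + 3)
    have h3 : ((n : K) + 3) ≠ 0 := by exact_mod_cast Nat.succ_ne_zero (n + 2)
    have h3' : ((n : K) + 2 + 1) ≠ 0 := by exact_mod_cast Nat.succ_ne_zero (n + 2)
    rw [Nat.factorial_succ (n + 3), Nat.factorial_succ (n + 2), Nat.factorial_succ (n + 1)]
    push_cast
    -- All harmonic sums are now expressed through these two, so what remains is a rational identity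
    -- in `n` with them as free variables.
    generalize nestedHarmonic K (n + 2) ![1] = x
    generalize nestedHarmonic K (n + 3) ![1, 1] = y
    field_simp
    ring

end Coefficients

theorem corollary3p10 (K : Type*) [Field K] [CharZero K] :
    (∀ φ : NCPAlg K →ₐ[K] K[X], IsDoubleBialgHom K φ → φ = phiNCP K) ∧
    (∀ n : ℕ, 1 ≤ n → ncP K n = ∑ i ∈ Finset.Icc 1 n, ncCoeff K i n • hilbertPoly K i) ∧
    (∀ n : ℕ, 1 ≤ n → ncCoeff K 1 n = if n = 1 then 1 else 0) ∧
    (∀ i n : ℕ, 2 ≤ i → i ≤ n →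
      ncCoeff K i n =
        ∑ k ∈ Finset.Icc 1 ((n + 1) / 2),
          ((n - k + 1).choose k : K) * ncCoeff K (i - 1) (n - k)) ∧
    (∀ n : ℕ, 1 ≤ n → ncCoeff K n n = (n.factorial : K)) ∧
    (∀ n : ℕ, 2 ≤ n →
      ncCoeff K (n - 1) n =
        (n.factorial : K) * (((n : K) + 1) / 2 - nestedHarmonic K n ![1])) ∧
    (∀ n : ℕ, 3 ≤ n →
      ncCoeff K (n - 2) n =
        (n.factorial : K) *
          (nestedHarmonic K n ![1, 1] - (n : K) / 2 * nestedHarmonic K n ![1] +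
            (3 * (n : K) - 2) * ((n : K) ^ 2 + (n : K) + 6) / (24 * (n : K)))) := by
  refine ⟨fun φ hφ => hφ.eq_phiNCP, fun n hn => ncP_eq_sum K (by omega),
    fun n hn => ncCoeff_one K (by omega),
    fun i n hi hn => ncCoeff_recurrence K hi (hi.trans hn), fun n hn => ?_, fun n hn => ?_,
    fun n hn => ?_⟩
  · obtain ⟨n, rfl⟩ := Nat.exists_eq_add_of_le' hn
    exact ncCoeff_self K n
  · obtain ⟨n, rfl⟩ := Nat.exists_eq_add_of_le' hn
    have h := ncCoeff_pred K n
    rw [show n + 2 - 1 = n + 1 from rfl, h]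
    push_cast
    ring
  · obtain ⟨n, rfl⟩ := Nat.exists_eq_add_of_le' hn
    have h := ncCoeff_pred_pred K n
    rw [show n + 3 - 2 = n + 1 from rfl, h]
    push_cast
    rfl
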